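/- Let $N\ge 1$ and let $\Lambda=(\lambda_{ij})$ be a positive definite real symmetric $N\times N$ matrix. Let $X=(X_1,\dots,X_N)$ be a random vector whose law has a density of the form $$|\Lambda|^{-1/2}\,g\big((x-\mu)'\Lambda^{-1}(x-\mu)\big),\qquad x\in\mathbb R^N,$$ for some $\mu\in\mathbb R^N$ and some measurable $g$ with $g\ge 0$ on $[0,\infty)$ and $\int_{\mathbb R^N} g(y'y)\,dy=1$, and assume that the covariance matrix of $X$ exists (all $X_i$ are square integrable). Put $$\gamma^{P}_{ij}=\frac{\mathrm{Cov}(X_i,X_j)}{\sqrt{\mathrm{Cov}(X_i,X_i)}\sqrt{\mathrm{Cov}(X_j,X_j)}},\qquad \gamma^{Fh}_{ij}=2\,\mathbb P\{(X_i-\mathbb EX_i)(X_j-\mathbb EX_j)>0\}-1,$$ $$\gamma^{Kd}_{ij}=2\,\mathbb P\{(X^{(1)}_i-X^{(2)}_i)(X^{(1)}_j-X^{(2)}_j)>0\}-1,$$ the Pearson, Fechner and Kendall correlations, where $(X^{(1)}_i,X^{(1)}_j)$ and $(X^{(2)}_i,X^{(2)}_j)$ are independent and distributed as $(X_i,X_j)$.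 Then for all $i,j$ $$\gamma^{P}_{ij}=\frac{\lambda_{ij}}{\sqrt{\lambda_{ii}\lambda_{jj}}},\qquad \gamma^{Fh}_{ij}=\gamma^{Kd}_{ij}=\frac2\pi\arcsin\frac{\lambda_{ij}}{\sqrt{\lambda_{ii}\lambda_{jj}}}.$$ Moreover, call a spanning tree of the complete graph on $\{1,\dots,N\}$ with edge weights $\gamma_{ij}$ a maximum spanning tree (MST) if its total edge weight is maximal among all spanning trees. The set of MSTs is the same for $\gamma=\gamma^{P}$, $\gamma=\gamma^{Fh}$ and $\gamma=\gamma^{Kd}$, and it coincides with the set of MSTs of the Pearson (and of the Fechner, and of the Kendall) correlation network of an $N$-dimensional Gaussian vector with covariance matrix $\Lambda$ and any mean. In particular it depends only on $\Lambda$, not on $\mu$ or $g$. (If the MST is unique, this says that the true MST is the same in all these networks.) -/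

import Mathlib

open MeasureTheory ProbabilityTheory

noncomputable section

/-- Pearson correlation `Cov(U, V) / (√Cov(U, U) √Cov(V, V))`. -/
def pearson {Ω : Type*} [MeasurableSpace Ω] (P : Measure Ω) (U V : Ω → ℝ) : ℝ :=
  covariance U V P / (Real.sqrt (covariance U U P) * Real.sqrt (covariance V V P))

/-- Sign similarity `P{(U - E U)(V - E V) > 0}`. -/
def signSimilarity {Ω : Type*} [MeasurableSpace Ω] (P : Measure Ω) (U V : Ω → ℝ) : ℝ :=
  P.real {ω | 0 < (U ω - ∫ ω', U ω' ∂P) * (V ω - ∫ ω', V ω' ∂P)}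

/-- Fechner correlation `2 P{(U - E U)(V - E V) > 0} - 1`. -/
def fechner {Ω : Type*} [MeasurableSpace Ω] (P : Measure Ω) (U V : Ω → ℝ) : ℝ :=
  2 * signSimilarity P U V - 1

/-- Kendall correlation `2 P{(U₁ - U₂)(V₁ - V₂) > 0} - 1`, where `(U₁, V₁)` and `(U₂, V₂)` are
independent, each with the law of `(U, V)`; the joint law of these two pairs is the product
measure below. -/
def kendall {Ω : Type*} [MeasurableSpace Ω] (P : Measure Ω) (U V : Ω → ℝ) : ℝ :=
  2 * ((P.map fun ω => (U ω, V ω)).prod (P.map fun ω => (U ω, V ω))).real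
      {q | 0 < (q.1.1 - q.2.1) * (q.1.2 - q.2.2)} - 1

/-- The weight matrix `γ(X_i, X_j)` of the network model of the random variable network `(X, γ)`,
where `X` lives on a space with probability measure `P`. -/
def networkWeights {N : ℕ} {Ω : Type*} [MeasurableSpace Ω]
    (γ : Measure Ω → (Ω → ℝ) → (Ω → ℝ) → ℝ) (P : Measure Ω) (X : Fin N → Ω → ℝ) :
    Matrix (Fin N) (Fin N) ℝ :=
  Matrix.of fun i j => γ P (X i) (X j)

open Classical in
/-- The sum of the weights of the edges of `T`; the edge `{i, j}` with `i < j` has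
weight `W i j` (in the networks considered here `W` is symmetric). -/
def treeWeight {N : ℕ} (W : Matrix (Fin N) (Fin N) ℝ) (T : SimpleGraph (Fin N)) : ℝ :=
  ∑ e ∈ T.edgeFinset, W e.inf e.sup

/-- The set of all maximum spanning trees of the complete graph on `Fin N` with weights `W`
(it has several elements only if there are ties). -/
def maxSpanningTrees {N : ℕ} (W : Matrix (Fin N) (Fin N) ℝ) : Set (SimpleGraph (Fin N)) :=
  {T | T.IsTree ∧ ∀ T' : SimpleGraph (Fin N), T'.IsTree → treeWeight W T' ≤ treeWeight W T}

/-- The true maximum spanning trees of the random variable network `(X, γ)`. -/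
def trueMST {N : ℕ} {Ω : Type*} [MeasurableSpace Ω]
    (γ : Measure Ω → (Ω → ℝ) → (Ω → ℝ) → ℝ) (P : Measure Ω) (X : Fin N → Ω → ℝ) :
    Set (SimpleGraph (Fin N)) :=
  maxSpanningTrees (networkWeights γ P X)

/-- `|Λ|^{-1/2} g((x - μ)' Λ⁻¹ (x - μ))`. -/
def ellipticalDensity {N : ℕ} (Λ : Matrix (Fin N) (Fin N) ℝ) (μ : Fin N → ℝ) (g : ℝ → ℝ)
    (x : Fin N → ℝ) : ℝ :=
  Λ.det ^ (-(1 / 2) : ℝ) * g ((x - μ) ⬝ᵥ (Λ⁻¹.mulVec (x - μ)))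

/-- `X ∈ K(Λ)`: for some location `μ` and some generator `g ≥ 0` with `∫ g(y'y) dy = 1`, the random
vector `X` has the elliptical density with parameters `μ`, `Λ`, `g`. -/
def IsElliptical {N : ℕ} {Ω : Type*} [MeasurableSpace Ω] (Λ : Matrix (Fin N) (Fin N) ℝ)
    (P : Measure Ω) (X : Fin N → Ω → ℝ) : Prop :=
  ∃ (μ : Fin N → ℝ) (g : ℝ → ℝ), Measurable g ∧ (∀ u, 0 ≤ u → 0 ≤ g u) ∧
    (∫⁻ y : Fin N → ℝ, ENNReal.ofReal (g (y ⬝ᵥ y))) = 1 ∧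
    HasLaw (fun ω i => X i ω)
      (volume.withDensity fun x => ENNReal.ofReal (ellipticalDensity Λ μ g x)) P

/-- The coordinates `Z_1, …, Z_N` on `ℝ^N`, as random variables. -/
def coord {N : ℕ} (i : Fin N) (z : EuclideanSpace ℝ (Fin N)) : ℝ := z i

end

/-!
An elliptical vector `X` with parameters `μ`, `Λ` is `μ + Λ^{1/2} Y`, where the standardized vector
`Y = Λ^{-1/2} (X - μ)` has a density which depends on `‖y‖` only; so the distribution of `Y` is
invariant under all linear isometries. A Gaussian vector with covariance matrix `Λ` has the same
form, with `Y` standard Gaussian. In both cases `X i = μ i + ⟪a i, Y⟫`, where the rows `a i` of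
`Λ^{1/2}` have Gram matrix `Λ` (`HasSphericalRepresentation`). The three correlations follow from
this form alone (`HasSphericalRepresentation.correlations`).

* By invariance, `E ⟪v, Y⟫ ^ 2` is a constant times `‖v‖ ^ 2`; by polarization the covariance matrix
  of `X` is a positive multiple of `Λ` (`IsSpherical.integral_inner_mul_inner`), which gives the
  Pearson correlation.
* If `φ` is the angle between `a` and `b`, then `⟪a, Y⟫` and `⟪b, Y⟫` have the same sign with
  probability `1 - φ / π` (`IsSpherical.measure_inner_mul_inner_pos`): the average of the indicator
  of this event over the reflections of the plane of `a` and `b` is this constant, whatever the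
  value of `Y`, as long as it is not orthogonal to the plane. As `φ = π / 2 - arcsin (cos φ)`, this
  gives the Fechner correlation. The difference of two independent copies of `Y` is spherical too
  (`IsSpherical.map_sub_prod`), which gives the Kendall correlation.

The function `ρ ↦ 2 / π * arcsin ρ` is strictly increasing on `[-1, 1]`, so the networks have
weights in the same order, and maximum spanning trees depend only on this order
(`maxSpanningTrees_eq_of_le_iff`). Indeed, by the exchange property of spanning trees
(`SimpleGraph.IsTree.exists_exchange`), a tree is maximal as soon as no exchange of a single edge
increases its weight (`mem_maxSpanningTrees_iff`).
-/

open scoped RealInnerProductSpace MatrixOrder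

/-! ### Exchange of edges in spanning trees, and maximality -/

namespace SimpleGraph

variable {V : Type*} {T T' : SimpleGraph V} {u v x y : V}

lemma Connected.reachable_deleteEdges_or (hT : T.Connected) (x y z : V) :
    (T.deleteEdges {s(x, y)}).Reachable z x ∨ (T.deleteEdges {s(x, y)}).Reachable z y := by
  obtain ⟨p⟩ := hT.preconnected z x
  -- the end of the walk is a variable, so that the induction applies
  suffices H : ∀ {a b : V} (_ : T.Walk a b), b = x →
      (T.deleteEdges {s(x, y)}).Reachable a x ∨ (T.deleteEdges {s(x, y)}).Reachable a y from
    H p rfl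
  intro a b p hb
  induction p with
  | nil => subst hb; exact .inl .rfl
  | @cons a c b h p ih =>
    by_cases he : s(a, c) = s(x, y)
    · rcases Sym2.eq_iff.1 he with ⟨rfl, -⟩ | ⟨rfl, -⟩
      · exact .inl .rfl
      · exact .inr .rfl
    · have hac : (T.deleteEdges {s(x, y)}).Reachable a c :=
        Adj.reachable (by simpa [deleteEdges_adj, h] using he)
      exact (ih hb).imp hac.trans hac.trans

/-- Replacing an edge `xy` of a tree by a pair `uv` which it separates gives a tree again. -/
lemma IsTree.swap (hT : T.IsTree) (huv : ¬ (T.deleteEdges {s(x, y)}).Reachable u v) :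
    (T.deleteEdges {s(x, y)} ⊔ edge u v).IsTree := by
  have hne : u ≠ v := fun h => huv (h ▸ .rfl)
  have hle : T.deleteEdges {s(x, y)} ≤ T.deleteEdges {s(x, y)} ⊔ edge u v := le_sup_left
  have huv' : (T.deleteEdges {s(x, y)} ⊔ edge u v).Reachable u v :=
    Adj.reachable (by simp [edge_adj, hne])
  have hxy : (T.deleteEdges {s(x, y)} ⊔ edge u v).Reachable x y := by
    rcases hT.connected.reachable_deleteEdges_or x y u with hu | hu <;>
      rcases hT.connected.reachable_deleteEdges_or x y v with hv | hv
    · exact (huv (hu.trans hv.symm)).elim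
    · exact ((hu.mono hle).symm.trans huv').trans (hv.mono hle)
    · exact ((hv.mono hle).symm.trans huv'.symm).trans (hu.mono hle)
    · exact (huv (hu.trans hv.symm)).elim
  refine ⟨(connected_iff_exists_forall_reachable _).2 ⟨x, fun z => ?_⟩,
    (hT.isAcyclic.anti (deleteEdges_le _)).sup_edge_of_not_reachable huv⟩
  rcases hT.connected.reachable_deleteEdges_or x y z with hz | hz
  · exact (hz.mono hle).symm
  · exact hxy.trans (hz.mono hle).symm

/-- In a tree, every edge of the path from `u` to `v` separates `u` from `v`. -/
lemma IsAcyclic.not_reachable_of_mem_edges (hT : T.IsAcyclic) {p : T.Walk u v} (hp : p.IsPath)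
    (h : s(x, y) ∈ p.edges) : ¬ (T.deleteEdges {s(x, y)}).Reachable u v := by
  classical
  rw [reachable_deleteEdges_iff_exists_walk]
  rintro ⟨q, hq⟩
  have : q.toPath = ⟨p, hp⟩ := (hT.subsingleton_path u v).elim _ _
  refine hq (Walk.edges_toPath_subset_edges q ?_)
  rw [this]
  exact h

/-- The symmetric exchange property of spanning trees: an edge `uv` of `T'` can be
exchanged with an edge `xy` of `T` such that both graphs stay trees. By `IsTree.swap`, this amounts
to `xy` separating `u` from `v` in `T` and `uv` separating `x` from `y` in `T'`. -/
lemma IsTree.exists_exchange (hT : T.IsTree) (hT' : T'.IsTree) (h' : T'.Adj u v) :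
    ∃ x y, T.Adj x y ∧ ¬ (T.deleteEdges {s(x, y)}).Reachable u v ∧
      ¬ (T'.deleteEdges {s(u, v)}).Reachable x y := by
  obtain ⟨p, hp⟩ := hT.connected.exists_isPath u v
  have hbr : ¬ (T'.deleteEdges {s(u, v)}).Reachable u v :=
    isBridge_iff.1 (isAcyclic_iff_forall_isBridge.1 hT'.isAcyclic ((mem_edgeSet _).2 h'))
  -- the path in `T` has to cross the cut which `uv` defines in `T'`
  obtain ⟨d, hd, hx, hy⟩ :=
    p.exists_boundary_dart {z | (T'.deleteEdges {s(u, v)}).Reachable u z} .rfl hbr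
  have hxy : ¬ (T'.deleteEdges {s(u, v)}).Reachable d.fst d.snd := fun hr => hy (hx.trans hr)
  exact ⟨d.fst, d.snd, d.adj,
    hT.isAcyclic.not_reachable_of_mem_edges hp (List.mem_map_of_mem hd), hxy⟩

lemma IsTree.eq_of_le (hT : T.IsTree) (hT' : T'.IsTree) (h : T' ≤ T) : T' = T :=
  le_antisymm h ((isTree_iff_minimal_connected.1 hT).2 hT'.connected h)

end SimpleGraph

section MaxSpanningTree

open SimpleGraph

variable {N : ℕ} {W W' : Matrix (Fin N) (Fin N) ℝ} {T T' : SimpleGraph (Fin N)} {u v x y : Fin N}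

open Classical in
lemma edgeFinset_swap (huv : ¬ (T.deleteEdges {s(x, y)}).Reachable u v) :
    (T.deleteEdges {s(x, y)} ⊔ edge u v).edgeFinset =
      insert s(u, v) (T.edgeFinset.erase s(x, y)) := by
  have hne : u ≠ v := fun h => huv (h ▸ .rfl)
  ext e
  simp only [mem_edgeFinset, edgeSet_sup, edgeSet_deleteEdges, edgeSet_edge_of_ne hne,
    Finset.mem_insert, Finset.mem_erase, Set.mem_union, Set.mem_sdiff, Set.mem_singleton_iff]
  tauto

lemma treeWeight_swap (hxy : T.Adj x y) (huv : ¬ (T.deleteEdges {s(x, y)}).Reachable u v) :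
    treeWeight W (T.deleteEdges {s(x, y)} ⊔ edge u v) + W s(x, y).inf s(x, y).sup =
      treeWeight W T + W s(u, v).inf s(u, v).sup := by
  classical
  have hne : u ≠ v := fun h => huv (h ▸ .rfl)
  have hmem : s(x, y) ∈ T.edgeFinset := by simpa using hxy
  have hnot : s(u, v) ∉ T.edgeFinset.erase s(x, y) := by
    intro h
    rw [Finset.mem_erase, mem_edgeFinset, mem_edgeSet] at h
    exact huv (Adj.reachable (by simpa [deleteEdges_adj, h.2] using h.1))
  have e1 : treeWeight W (T.deleteEdges {s(x, y)} ⊔ edge u v) =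
      ∑ e ∈ insert s(u, v) (T.edgeFinset.erase s(x, y)), W e.inf e.sup := by
    unfold treeWeight
    exact Finset.sum_congr (by convert edgeFinset_swap huv) fun _ _ => rfl
  have e2 : treeWeight W T = ∑ e ∈ T.edgeFinset, W e.inf e.sup := by
    unfold treeWeight
    exact Finset.sum_congr (by congr!) fun _ _ => rfl
  rw [e1, e2, Finset.sum_insert hnot, ← Finset.add_sum_erase _ _ hmem]
  ring

/-- A local criterion for maximality: a spanning tree is maximal iff no pair `uv` is heavier than an
edge of the tree that separates `u` from `v`. -/
lemma mem_maxSpanningTrees_iff :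
    T ∈ maxSpanningTrees W ↔ T.IsTree ∧ ∀ u v x y, T.Adj x y →
      ¬ (T.deleteEdges {s(x, y)}).Reachable u v →
        W s(u, v).inf s(u, v).sup ≤ W s(x, y).inf s(x, y).sup := by
  classical
  refine ⟨fun ⟨hT, hmax⟩ => ⟨hT, fun u v x y hxy huv => ?_⟩, fun ⟨hT, hloc⟩ => ⟨hT, ?_⟩⟩
  · have h1 := hmax _ (hT.swap huv)
    have h2 := treeWeight_swap (W := W) hxy huv
    linarith
  · -- exchanging edges moves a competitor towards `T` without losing weight
    suffices H : ∀ (n : ℕ) (T' : SimpleGraph (Fin N)), T'.IsTree →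
        (T'.edgeFinset \ T.edgeFinset).card = n → treeWeight W T' ≤ treeWeight W T from
      fun T' hT' => H _ T' hT' rfl
    intro n
    induction n using Nat.strong_induction_on with
    | _ n ih =>
      intro T' hT' hn
      by_cases hle : T' ≤ T
      · rw [hT.eq_of_le hT' hle]
      obtain ⟨u, v, h', h⟩ : ∃ u v, T'.Adj u v ∧ ¬ T.Adj u v := by
        by_contra! hcon
        exact hle fun a b => hcon a b
      obtain ⟨x, y, hxy, huv, hsep⟩ := hT.exists_exchange hT' h'
      have h1 := treeWeight_swap (W := W) h' hsep
      have h2 := hloc u v x y hxy huv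
      have hlt : (T'.deleteEdges {s(u, v)} ⊔ edge x y).edgeFinset \ T.edgeFinset ⊂
          T'.edgeFinset \ T.edgeFinset := by
        have hsub : (T'.deleteEdges {s(u, v)} ⊔ edge x y).edgeFinset =
            insert s(x, y) (T'.edgeFinset.erase s(u, v)) := by
          convert edgeFinset_swap hsep
        rw [hsub, Finset.ssubset_iff_of_subset]
        · exact ⟨s(u, v), by simp [h', h], by
            simp only [Finset.mem_sdiff, Finset.mem_insert, Finset.mem_erase, ne_eq,
              not_true_eq_false, false_and, or_false, mem_edgeFinset, mem_edgeSet, h,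
              not_false_eq_true, and_true]
            intro he
            exact h (by rw [← mem_edgeSet, he]; exact hxy)⟩
        · intro e he
          simp only [Finset.mem_sdiff, Finset.mem_insert, Finset.mem_erase, mem_edgeFinset] at he ⊢
          rcases he with ⟨rfl | he, hT⟩
          · exact (hT hxy).elim
          · exact ⟨he.2, hT⟩
      have h3 := ih _ (hn ▸ Finset.card_lt_card hlt) _ (hT'.swap hsep) (by congr!)
      linarith

/-- The maximum spanning trees depend only on the order of the weights, as the criterion
`mem_maxSpanningTrees_iff` only compares weights. -/
lemma maxSpanningTrees_eq_of_le_iff (h : ∀ i j k l, W i j ≤ W k l ↔ W' i j ≤ W' k l) :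
    maxSpanningTrees W = maxSpanningTrees W' := by
  ext T
  simp only [mem_maxSpanningTrees_iff, h]

end MaxSpanningTree

/-! ### Spherical distributions and Sheppard's formula -/

section AngleMeasure

lemma setIntegral_indicator_cos {φ : ℝ} (h0 : 0 ≤ φ) (hπ : φ ≤ Real.pi) :
    ∫ t in (-Real.pi)..Real.pi, {t | 0 < Real.cos t + Real.cos φ}.indicator 1 t =
      2 * (Real.pi - φ) := by
  have hpi := Real.pi_pos
  have hm : MeasurableSet {t : ℝ | 0 < Real.cos t + Real.cos φ} :=
    measurableSet_lt measurable_const (by fun_prop)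
  rw [intervalIntegral.integral_of_le (by linarith), setIntegral_indicator hm]
  have hset : Set.Ioc (-Real.pi) Real.pi ∩ {t | 0 < Real.cos t + Real.cos φ} =
      Set.Ioo (-(Real.pi - φ)) (Real.pi - φ) := by
    ext t
    simp only [Set.mem_inter_iff, Set.mem_Ioc, Set.mem_ofPred_eq, Set.mem_Ioo, ← abs_lt]
    have key : |t| ≤ Real.pi → (0 < Real.cos t + Real.cos φ ↔ |t| < Real.pi - φ) := fun ht => by
      rw [← Real.cos_abs t, ← Real.strictAntiOn_cos.lt_iff_gt
        ⟨by linarith, by linarith⟩ ⟨abs_nonneg t, ht⟩, Real.cos_pi_sub]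
      constructor <;> intro h <;> linarith
    constructor
    · rintro ⟨⟨h1, h2⟩, h3⟩
      exact (key (abs_le.2 ⟨h1.le, h2⟩)).1 h3
    · intro h
      have h' := abs_lt.1 h
      exact ⟨⟨by linarith, by linarith⟩, (key (by linarith)).2 h⟩
  rw [hset]
  simp only [Pi.one_apply, integral_const, smul_eq_mul, mul_one, measureReal_restrict_apply_univ,
    Real.volume_real_Ioo]
  rw [max_eq_left (by linarith)]
  ring

/-- For a nonzero vector `(p, q)` of the plane, consider its reflections in the lines of direction
`θ / 2`. Those `θ ∈ (0, π]` for which the reflected vector has inner products of the same sign with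
two given vectors at angle `φ` have measure `π - φ`: the product of the inner products is a positive
multiple of `cos (2 θ - d) + cos φ` for some `d`. -/
lemma volume_reflection_same_side {φ p q : ℝ} (h0 : 0 ≤ φ) (hπ : φ ≤ Real.pi)
    (hpq : p ≠ 0 ∨ q ≠ 0) :
    volume ({θ | 0 < (Real.cos θ * p + Real.sin θ * q) *
        (Real.cos φ * (Real.cos θ * p + Real.sin θ * q) +
          Real.sin φ * (Real.sin θ * p - Real.cos θ * q))} ∩ Set.Ioc 0 Real.pi) =
      ENNReal.ofReal (Real.pi - φ) := by
  have hpi := Real.pi_pos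
  set z : ℂ := ⟨p, q⟩
  have hz : 0 < ‖z‖ := by
    rw [norm_pos_iff]
    intro h
    have h1 : p = 0 := congrArg Complex.re h
    have h2 : q = 0 := congrArg Complex.im h
    tauto
  have hp : ‖z‖ * Real.cos z.arg = p := Complex.norm_mul_cos_arg z
  have hq : ‖z‖ * Real.sin z.arg = q := Complex.norm_mul_sin_arg z
  set r := ‖z‖
  set ψ := z.arg
  have hset : {θ | 0 < (Real.cos θ * p + Real.sin θ * q) *
        (Real.cos φ * (Real.cos θ * p + Real.sin θ * q) +
          Real.sin φ * (Real.sin θ * p - Real.cos θ * q))} =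
      {θ | 0 < Real.cos (2 * θ - (2 * ψ + φ)) + Real.cos φ} := by
    ext θ
    have e1 : Real.cos θ * p + Real.sin θ * q = r * Real.cos (θ - ψ) := by
      rw [Real.cos_sub, ← hp, ← hq]; ring
    have e2 : Real.sin θ * p - Real.cos θ * q = r * Real.sin (θ - ψ) := by
      rw [Real.sin_sub, ← hp, ← hq]; ring
    have e3 : Real.cos (2 * θ - (2 * ψ + φ)) + Real.cos φ =
        2 * (Real.cos (θ - ψ) * Real.cos (θ - ψ - φ)) := by
      rw [Real.cos_add_cos]
      ring_nf
    have e4 : (r * Real.cos (θ - ψ)) * (Real.cos φ * (r * Real.cos (θ - ψ)) +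
        Real.sin φ * (r * Real.sin (θ - ψ))) =
          (r ^ 2 / 2) * (Real.cos (2 * θ - (2 * ψ + φ)) + Real.cos φ) := by
      rw [e3, Real.cos_sub (θ - ψ) φ]; ring
    simp only [Set.mem_ofPred_eq, e1, e2, e4]
    exact mul_pos_iff_of_pos_left (by positivity)
  rw [hset]
  have hm : MeasurableSet {θ : ℝ | 0 < Real.cos (2 * θ - (2 * ψ + φ)) + Real.cos φ} :=
    measurableSet_lt measurable_const (by fun_prop)
  set F : ℝ → ℝ := {t | 0 < Real.cos t + Real.cos φ}.indicator 1 with hF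
  have hper : Function.Periodic F (2 * Real.pi) := fun t => by
    simp only [hF, Set.indicator, Set.mem_ofPred_eq, Real.cos_add_two_pi, Pi.one_apply]
  have hint : ∫ θ in (0 : ℝ)..Real.pi, F (2 * θ - (2 * ψ + φ)) = Real.pi - φ := by
    rw [intervalIntegral.integral_comp_mul_sub F two_ne_zero]
    have := hper.intervalIntegral_add_eq (2 * 0 - (2 * ψ + φ)) (-Real.pi)
    rw [show 2 * Real.pi - (2 * ψ + φ) = 2 * 0 - (2 * ψ + φ) + 2 * Real.pi by ring, this,
      show -Real.pi + 2 * Real.pi = Real.pi by ring, setIntegral_indicator_cos h0 hπ, smul_eq_mul]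
    ring
  have hind : (fun θ => F (2 * θ - (2 * ψ + φ))) =
      {θ | 0 < Real.cos (2 * θ - (2 * ψ + φ)) + Real.cos φ}.indicator 1 := rfl
  rw [intervalIntegral.integral_of_le hpi.le, hind, setIntegral_indicator hm] at hint
  simp only [Pi.one_apply, integral_const, smul_eq_mul, mul_one,
    measureReal_restrict_apply_univ] at hint
  rw [← hint, Set.inter_comm,
    ofReal_measureReal ((measure_mono Set.inter_subset_left).trans_lt (by simp)).ne]

end AngleMeasure

section Spherical

variable {E : Type*} [NormedAddCommGroup E] [InnerProductSpace ℝ E]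

/-- The reflection in the line of direction `cos (θ/2) e₁ + sin (θ/2) e₂`, in coordinates. Unlike a
rotation of the plane of `e₁` and `e₂`, it needs no extension to the whole space. -/
lemma exists_isometry_inner {e₁ e₂ : E} (h1 : ‖e₁‖ = 1) (h2 : ‖e₂‖ = 1) (h12 : ⟪e₁, e₂⟫ = 0)
    (θ : ℝ) : ∃ R : E ≃ₗᵢ[ℝ] E, ∀ y,
      ⟪e₁, R y⟫ = Real.cos θ * ⟪e₁, y⟫ + Real.sin θ * ⟪e₂, y⟫ ∧
      ⟪e₂, R y⟫ = Real.sin θ * ⟪e₁, y⟫ - Real.cos θ * ⟪e₂, y⟫ := by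
  have h11 : ⟪e₁, e₁⟫ = 1 := by rw [real_inner_self_eq_norm_sq, h1]; norm_num
  have h22 : ⟪e₂, e₂⟫ = 1 := by rw [real_inner_self_eq_norm_sq, h2]; norm_num
  have h21 : ⟪e₂, e₁⟫ = 0 := by rw [real_inner_comm, h12]
  set u := Real.cos (θ / 2) • e₁ + Real.sin (θ / 2) • e₂ with hu
  have hsc := Real.sin_sq_add_cos_sq (θ / 2)
  have hun : ‖u‖ ^ 2 = 1 := by
    rw [← real_inner_self_eq_norm_sq, hu]
    simp only [inner_add_left, inner_add_right, inner_smul_left, inner_smul_right, h11, h22, h12,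
      h21, RCLike.conj_to_real]
    linarith
  have hcos : Real.cos θ = 2 * Real.cos (θ / 2) ^ 2 - 1 := by
    rw [← Real.cos_two_mul]; ring_nf
  have hsin : Real.sin θ = 2 * Real.sin (θ / 2) * Real.cos (θ / 2) := by
    rw [← Real.sin_two_mul]; ring_nf
  have huy : ∀ y, ⟪u, y⟫ = Real.cos (θ / 2) * ⟪e₁, y⟫ + Real.sin (θ / 2) * ⟪e₂, y⟫ := fun y => by
    simp [hu, inner_add_left, inner_smul_left]
  refine ⟨(ℝ ∙ u).reflection, fun y => ?_⟩
  simp only [Submodule.reflection_singleton_apply, RCLike.ofReal_real_eq_id, id, hun, div_one, huy,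
    inner_sub_right, two_smul, inner_add_right, inner_smul_right]
  simp only [hu, inner_add_right, inner_smul_right, h11, h22, h12, h21, hcos, hsin]
  constructor
  · ring
  · linear_combination (2 * ⟪e₂, y⟫) * hsc

variable [MeasurableSpace E]

/-- A measure on a Euclidean space is spherical if it is invariant under all linear isometries. As
part of the notion, affine hyperplanes have measure zero (so, in positive dimension, the Dirac
measure at the origin is excluded): the sign of a nonzero linear form is then almost surely nonzero. -/
structure IsSpherical (ν : Measure E) : Prop where
  map_eq : ∀ R : E ≃ₗᵢ[ℝ] E, ν.map R = ν
  hyperplane_null : ∀ v : E, v ≠ 0 → ∀ c : ℝ, ν {y | ⟪v, y⟫ = c} = 0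

namespace IsSpherical

variable {ν : Measure E} {a b : E}

lemma ae_inner_ne_zero (hν : IsSpherical ν) (ha : a ≠ 0) : ∀ᵐ y ∂ν, ⟪a, y⟫ ≠ 0 := by
  simpa [ae_iff] using hν.hyperplane_null a ha 0

lemma integral_inner_sq_pos [IsProbabilityMeasure ν] (hν : IsSpherical ν) (ha : a ≠ 0)
    (hm : MemLp (fun y => ⟪a, y⟫) 2 ν) : 0 < ∫ y, ⟪a, y⟫ ^ 2 ∂ν := by
  refine (integral_nonneg fun y => sq_nonneg _).lt_of_ne fun h => ?_
  have h0 := (integral_eq_zero_iff_of_nonneg (fun y => sq_nonneg _) hm.integrable_sq).1 h.symm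
  obtain ⟨y, hy, hy'⟩ := (h0.and (hν.ae_inner_ne_zero ha)).exists
  exact hy' (pow_eq_zero_iff two_ne_zero |>.1 hy)

variable [FiniteDimensional ℝ E] [BorelSpace E]

/-- The distribution of the difference of two independent copies is spherical. -/
lemma map_sub_prod [IsProbabilityMeasure ν] (hν : IsSpherical ν) :
    IsSpherical ((ν.prod ν).map fun p => p.1 - p.2) where
  map_eq R := by
    have hR : Measurable R := R.continuous.measurable
    rw [Measure.map_map hR (by fun_prop)]
    conv_rhs => rw [← hν.map_eq R, Measure.map_prod_map _ _ hR hR,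
      Measure.map_map (by fun_prop) (by fun_prop)]
    congr 1
    ext p
    simp
  hyperplane_null v hv c := by
    have hs : MeasurableSet {y : E | ⟪v, y⟫ = c} :=
      (isClosed_eq (by fun_prop) continuous_const).measurableSet
    rw [Measure.map_apply (by fun_prop) hs, Measure.prod_apply_symm ((by fun_prop :
      Measurable fun p : E × E => p.1 - p.2) hs)]
    refine (lintegral_congr fun y => ?_).trans lintegral_zero
    convert hν.hyperplane_null v hv (c + ⟪v, y⟫) using 2
    ext x
    simp [inner_sub_right, sub_eq_iff_eq_add]

/-- **Sheppard's formula** for spherical distributions, in the nondegenerate case. The probability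
is averaged over reflections of the plane of `a` and `b`. -/
lemma measure_inner_mul_inner_pos_of_sin_ne_zero [IsProbabilityMeasure ν] (hν : IsSpherical ν)
    (ha : a ≠ 0) (hb : b ≠ 0) (hsin : Real.sin (InnerProductGeometry.angle a b) ≠ 0) :
    ν.real {y | 0 < ⟪a, y⟫ * ⟪b, y⟫} = 1 - InnerProductGeometry.angle a b / Real.pi := by
  set φ := InnerProductGeometry.angle a b with hφ
  have hpi := Real.pi_pos
  have h0 : 0 ≤ φ := InnerProductGeometry.angle_nonneg a b
  have hπ : φ ≤ Real.pi := InnerProductGeometry.angle_le_pi a b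
  have hna : 0 < ‖a‖ := norm_pos_iff.2 ha
  have hnb : 0 < ‖b‖ := norm_pos_iff.2 hb
  have hsc := Real.sin_sq_add_cos_sq φ
  obtain ⟨e₁, he₁⟩ : ∃ e, e = ‖a‖⁻¹ • a := ⟨_, rfl⟩
  obtain ⟨b₁, hb₁⟩ : ∃ e, e = ‖b‖⁻¹ • b := ⟨_, rfl⟩
  obtain ⟨e₂, he₂⟩ : ∃ e, e = (Real.sin φ)⁻¹ • (b₁ - Real.cos φ • e₁) := ⟨_, rfl⟩
  have h1 : ‖e₁‖ = 1 := he₁ ▸ norm_smul_inv_norm (𝕜 := ℝ) ha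
  have hb1 : ‖b₁‖ = 1 := hb₁ ▸ norm_smul_inv_norm (𝕜 := ℝ) hb
  have h11 : ⟪e₁, e₁⟫ = 1 := by rw [real_inner_self_eq_norm_sq, h1]; norm_num
  have hbb : ⟪b₁, b₁⟫ = 1 := by rw [real_inner_self_eq_norm_sq, hb1]; norm_num
  have h1b : ⟪e₁, b₁⟫ = Real.cos φ := by
    rw [hφ, InnerProductGeometry.cos_angle, he₁, hb₁, inner_smul_left, inner_smul_right]
    simp only [RCLike.conj_to_real]
    field_simp
  have hb1' : ⟪b₁, e₁⟫ = Real.cos φ := by rw [real_inner_comm, h1b]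
  have h12 : ⟪e₁, e₂⟫ = 0 := by
    rw [he₂, inner_smul_right, inner_sub_right, inner_smul_right, h11, h1b]; ring
  have h2 : ‖e₂‖ = 1 := by
    rw [← sq_eq_sq₀ (norm_nonneg _) zero_le_one, ← real_inner_self_eq_norm_sq, he₂]
    simp only [inner_smul_right, inner_smul_left, inner_sub_left, inner_sub_right, h11, h1b, hb1',
      hbb, RCLike.conj_to_real]
    field_simp
    linarith
  have hay : ∀ y, ⟪a, y⟫ = ‖a‖ * ⟪e₁, y⟫ := fun y => by
    rw [he₁, inner_smul_left]; simp only [RCLike.conj_to_real]; field_simp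
  have hby : ∀ y, ⟪b, y⟫ = ‖b‖ * (Real.cos φ * ⟪e₁, y⟫ + Real.sin φ * ⟪e₂, y⟫) := fun y => by
    rw [he₂, inner_smul_left, inner_sub_left, inner_smul_left, hb₁, inner_smul_left]
    simp only [RCLike.conj_to_real]; field_simp; ring
  set S := {y : E | 0 < ⟪a, y⟫ * ⟪b, y⟫} with hS
  have hSm : MeasurableSet S := measurableSet_lt measurable_const (by fun_prop)
  -- the pairs `(θ, y)` such that the reflection with parameter `θ` maps `y` into `S`
  set Q : Set (ℝ × E) := {q | 0 < (Real.cos q.1 * ⟪e₁, q.2⟫ + Real.sin q.1 * ⟪e₂, q.2⟫) *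
        (Real.cos φ * (Real.cos q.1 * ⟪e₁, q.2⟫ + Real.sin q.1 * ⟪e₂, q.2⟫) +
          Real.sin φ * (Real.sin q.1 * ⟪e₁, q.2⟫ - Real.cos q.1 * ⟪e₂, q.2⟫))} with hQ
  have hQm : MeasurableSet Q := measurableSet_lt measurable_const (by fun_prop)
  have hslice : ∀ θ : ℝ, ν (Prod.mk θ ⁻¹' Q) = ν S := fun θ => by
    obtain ⟨R, hR⟩ := exists_isometry_inner h1 h2 h12 θ
    conv_rhs => rw [← hν.map_eq R, Measure.map_apply R.continuous.measurable hSm]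
    congr 1
    ext y
    simp only [hQ, hS, Set.mem_preimage, Set.mem_ofPred_eq, hay, hby, (hR y).1, (hR y).2]
    rw [mul_mul_mul_comm, mul_pos_iff_of_pos_left (mul_pos hna hnb)]
  have hleft : ((volume.restrict (Set.Ioc 0 Real.pi)).prod ν) Q =
      ν S * ENNReal.ofReal Real.pi := by
    rw [Measure.prod_apply hQm]
    simp [hslice]
  have hright : ((volume.restrict (Set.Ioc 0 Real.pi)).prod ν) Q =
      ENNReal.ofReal (Real.pi - φ) := by
    rw [Measure.prod_apply_symm hQm]
    have hae := hν.ae_inner_ne_zero (a := e₁) (norm_ne_zero_iff.1 (by rw [h1]; exact one_ne_zero))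
    rw [lintegral_congr_ae (g := fun _ => ENNReal.ofReal (Real.pi - φ)), lintegral_const,
      measure_univ, mul_one]
    filter_upwards [hae] with y hy
    rw [Measure.restrict_apply (measurable_prodMk_right hQm)]
    exact volume_reflection_same_side (q := ⟪e₂, y⟫) h0 hπ (.inl hy)
  have h := congrArg ENNReal.toReal (hleft.symm.trans hright)
  rw [ENNReal.toReal_mul, ENNReal.toReal_ofReal hpi.le, ENNReal.toReal_ofReal (by linarith)] at h
  rw [measureReal_def, eq_div_of_mul_eq hpi.ne' h]
  field_simp

/-- **Sheppard's formula** for spherical distributions: two linear forms have the same sign with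
probability `1 - φ / π`, where `φ` is the angle between them. -/
lemma measure_inner_mul_inner_pos [IsProbabilityMeasure ν] (hν : IsSpherical ν)
    (ha : a ≠ 0) (hb : b ≠ 0) :
    ν.real {y | 0 < ⟪a, y⟫ * ⟪b, y⟫} = 1 - InnerProductGeometry.angle a b / Real.pi := by
  by_cases hsin : Real.sin (InnerProductGeometry.angle a b) = 0
  · rcases InnerProductGeometry.sin_eq_zero_iff_angle_eq_zero_or_angle_eq_pi.1 hsin with h | h
    · rw [h]
      obtain ⟨-, r, hr, rfl⟩ := InnerProductGeometry.angle_eq_zero_iff.1 h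
      have hae : ∀ᵐ y ∂ν, y ∈ {y : E | 0 < ⟪a, y⟫ * ⟪r • a, y⟫} := by
        filter_upwards [hν.ae_inner_ne_zero ha] with y hy
        simp only [inner_smul_left, RCLike.conj_to_real, mul_left_comm]
        exact mul_pos hr (mul_self_pos.2 hy)
      have h1 : ν {y : E | 0 < ⟪a, y⟫ * ⟪r • a, y⟫} = 1 :=
        (measure_congr (Filter.eventuallyEq_univ.2 hae)).trans measure_univ
      rw [measureReal_def, h1]
      simp
    · rw [h]
      obtain ⟨-, r, hr, rfl⟩ := InnerProductGeometry.angle_eq_pi_iff.1 h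
      have : {y | 0 < ⟪a, y⟫ * ⟪r • a, y⟫} = (∅ : Set E) := by
        ext y
        simp only [inner_smul_left, RCLike.conj_to_real, Set.mem_ofPred_eq, Set.mem_empty_iff_false,
          iff_false, not_lt]
        nlinarith [mul_self_nonneg ⟪a, y⟫]
      simp [this, Real.pi_ne_zero]
  · exact hν.measure_inner_mul_inner_pos_of_sin_ne_zero ha hb hsin

/-- The form of Sheppard's formula in which the Fechner and Kendall correlations appear. -/
lemma two_mul_measure_sub_one [IsProbabilityMeasure ν] (hν : IsSpherical ν)
    (ha : a ≠ 0) (hb : b ≠ 0) :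
    2 * ν.real {y | 0 < ⟪a, y⟫ * ⟪b, y⟫} - 1 =
      2 / Real.pi * Real.arcsin (⟪a, b⟫ / (‖a‖ * ‖b‖)) := by
  rw [hν.measure_inner_mul_inner_pos ha hb, InnerProductGeometry.angle,
    Real.arccos_eq_pi_div_two_sub_arcsin]
  field_simp [Real.pi_ne_zero]
  ring

/-- The integral of a linear form vanishes, by invariance under `y ↦ -y`. -/
lemma integral_inner_eq_zero (hν : IsSpherical ν) (v : E) : ∫ y, ⟪v, y⟫ ∂ν = 0 := by
  have h := hν.map_eq (LinearIsometryEquiv.neg ℝ)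
  have h1 : ∫ y, ⟪v, y⟫ ∂ν = ∫ y, ⟪v, -y⟫ ∂ν := by
    conv_lhs => rw [← h, integral_map (by fun_prop) (by fun_prop)]
    simp
  simp only [inner_neg_right, integral_neg] at h1
  linarith

lemma integral_inner_sq_eq_of_norm_eq (hν : IsSpherical ν) {v w : E} (h : ‖v‖ = ‖w‖) :
    ∫ y, ⟪v, y⟫ ^ 2 ∂ν = ∫ y, ⟪w, y⟫ ^ 2 ∂ν := by
  set R := (ℝ ∙ (v - w))ᗮ.reflection
  have hR : R v = w := Submodule.reflection_sub h
  conv_rhs => rw [← hν.map_eq R, integral_map (by fun_prop) (by fun_prop), ← hR]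
  simp only [LinearIsometryEquiv.inner_map_map]

/-- The second moments of the linear forms are proportional to their squared norms. -/
lemma integral_inner_sq_mul (hν : IsSpherical ν) (v w : E) :
    (∫ y, ⟪v, y⟫ ^ 2 ∂ν) * ‖w‖ ^ 2 = (∫ y, ⟪w, y⟫ ^ 2 ∂ν) * ‖v‖ ^ 2 := by
  have hs : ∀ (c : ℝ) (x : E), ∫ y, ⟪c • x, y⟫ ^ 2 ∂ν = c ^ 2 * ∫ y, ⟪x, y⟫ ^ 2 ∂ν := fun c x => by
    simp only [inner_smul_left, RCLike.conj_to_real, mul_pow, integral_const_mul]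
  have h := hν.integral_inner_sq_eq_of_norm_eq (v := ‖w‖ • v) (w := ‖v‖ • w)
    (by simp [norm_smul, mul_comm])
  rw [hs, hs] at h
  linarith

/-- The covariance of two linear forms is proportional to their inner product. -/
lemma integral_inner_mul_inner [IsProbabilityMeasure ν] (hν : IsSpherical ν)
    (ha : MemLp (fun y => ⟪a, y⟫) 2 ν) (hb : MemLp (fun y => ⟪b, y⟫) 2 ν) (w : E) :
    (∫ y, ⟪a, y⟫ * ⟪b, y⟫ ∂ν) * ‖w‖ ^ 2 = (∫ y, ⟪w, y⟫ ^ 2 ∂ν) * ⟪a, b⟫ := by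
  have hpol : ∫ y, ⟪a, y⟫ * ⟪b, y⟫ ∂ν =
      ((∫ y, ⟪a + b, y⟫ ^ 2 ∂ν) - ∫ y, ⟪a - b, y⟫ ^ 2 ∂ν) / 4 := by
    rw [← integral_sub, ← integral_div]
    · congr 1
      ext y
      rw [inner_add_left, inner_sub_left]
      ring
    · simpa only [inner_add_left] using! (ha.add hb).integrable_sq
    · simpa only [inner_sub_left] using! (ha.sub hb).integrable_sq
  have h1 := hν.integral_inner_sq_mul (a + b) w
  have h2 := hν.integral_inner_sq_mul (a - b) w
  rw [hpol]
  rw [norm_add_sq_real] at h1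
  rw [norm_sub_sq_real] at h2
  linear_combination (h1 - h2) / 4

end IsSpherical

end Spherical

/-! ### Spherical representations of elliptical and Gaussian vectors -/

section SphericalRepresentation

variable {N : ℕ} {Λ : Matrix (Fin N) (Fin N) ℝ} {Ω : Type*} [MeasurableSpace Ω] {P : Measure Ω}
  {X : Fin N → Ω → ℝ}

/-- The random variables `X i` are, up to constants, linear forms `⟪a i, Y⟫` in a random vector `Y`
with spherical distribution, where the vectors `a i` have Gram matrix `Λ`. This covers elliptical
and Gaussian vectors alike. -/
def HasSphericalRepresentation (Λ : Matrix (Fin N) (Fin N) ℝ) (P : Measure Ω)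
    (X : Fin N → Ω → ℝ) : Prop :=
  ∃ (m : Fin N → ℝ) (a : Fin N → EuclideanSpace ℝ (Fin N)) (Y : Ω → EuclideanSpace ℝ (Fin N)),
    (∀ i j, ⟪a i, a j⟫ = Λ i j) ∧ AEMeasurable Y P ∧ IsSpherical (P.map Y) ∧
      ∀ i ω, X i ω = m i + ⟪a i, Y ω⟫

lemma norm_mul_norm_eq_sqrt {E : Type*} [NormedAddCommGroup E] [InnerProductSpace ℝ E]
    {a : Fin N → E} (ha : ∀ i j, ⟪a i, a j⟫ = Λ i j) (i j : Fin N) :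
    ‖a i‖ * ‖a j‖ = Real.sqrt (Λ i i * Λ j j) := by
  rw [← ha i i, ← ha j j, real_inner_self_eq_norm_sq, real_inner_self_eq_norm_sq, ← mul_pow,
    Real.sqrt_sq (by positivity)]

lemma HasSphericalRepresentation.correlations [IsProbabilityMeasure P]
    (hX : HasSphericalRepresentation Λ P X) (hΛ : Λ.PosDef) (hcov : ∀ i, MemLp (X i) 2 P)
    (i j : Fin N) :
    pearson P (X i) (X j) = Λ i j / Real.sqrt (Λ i i * Λ j j) ∧
      fechner P (X i) (X j) =
        2 / Real.pi * Real.arcsin (Λ i j / Real.sqrt (Λ i i * Λ j j)) ∧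
      kendall P (X i) (X j) =
        2 / Real.pi * Real.arcsin (Λ i j / Real.sqrt (Λ i i * Λ j j)) := by
  obtain ⟨m, a, Y, ha, hY, hν, hXY⟩ := hX
  set ν := P.map Y
  have : IsProbabilityMeasure ν := Measure.isProbabilityMeasure_map hY
  have hfun : ∀ i, X i = fun ω => m i + ⟪a i, Y ω⟫ := fun i => funext (hXY i)
  have hdiag : ∀ i, 0 < Λ i i := fun i => hΛ.diag_pos
  have ha0 : ∀ i, a i ≠ 0 := fun i h => by
    have := hdiag i
    rw [← ha i i, h, inner_zero_left] at this
    exact this.false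
  have hmem : ∀ i, MemLp (fun y => ⟪a i, y⟫) 2 ν := fun i => by
    rw [memLp_map_measure_iff (by fun_prop) hY]
    convert (hcov i).sub (memLp_const (m i)) using 1
    ext ω
    simp [hXY]
  have hmean : ∀ i, ∫ ω, X i ω ∂P = m i := fun i => by
    have h0 : ∫ ω, ⟪a i, Y ω⟫ ∂P = 0 := by
      rw [← integral_map (φ := Y) (f := fun y => ⟪a i, y⟫) hY (by fun_prop)]
      exact hν.integral_inner_eq_zero (a i)
    have hint : Integrable (fun ω => ⟪a i, Y ω⟫) P :=
      ((hmem i).integrable (by norm_num)).comp_aemeasurable hY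
    rw [hfun i, integral_add (integrable_const _) hint, h0]
    simp
  have hcentred : ∀ i ω, X i ω - ∫ ω', X i ω' ∂P = ⟪a i, Y ω⟫ := fun i ω => by
    rw [hmean, hXY, add_sub_cancel_left]
  refine ⟨?_, ?_, ?_⟩
  · -- the covariance matrix is `c • Λ`, and `c` cancels
    set c := (∫ y, ⟪a i, y⟫ ^ 2 ∂ν) / Λ i i with hc
    have hcpos : 0 < c := div_pos (hν.integral_inner_sq_pos (ha0 i) (hmem i)) (hdiag i)
    have hcovar : ∀ k l, covariance (X k) (X l) P = c * Λ k l := fun k l => by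
      have h1 : covariance (X k) (X l) P = ∫ y, ⟪a k, y⟫ * ⟪a l, y⟫ ∂ν := by
        simp only [covariance, hcentred]
        exact (integral_map (φ := Y) (f := fun y => ⟪a k, y⟫ * ⟪a l, y⟫) hY (by fun_prop)).symm
      have h2 := hν.integral_inner_mul_inner (hmem k) (hmem l) (a i)
      rw [← real_inner_self_eq_norm_sq, ha, ha] at h2
      rw [h1, hc, div_mul_eq_mul_div, eq_div_iff (hdiag i).ne', h2]
    rw [pearson, hcovar, hcovar, hcovar, Real.sqrt_mul hcpos.le, Real.sqrt_mul hcpos.le,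
      mul_mul_mul_comm, Real.mul_self_sqrt hcpos.le, ← Real.sqrt_mul (hdiag i).le,
      mul_div_mul_left _ _ hcpos.ne']
  · rw [fechner, signSimilarity, ← ha i j, ← norm_mul_norm_eq_sqrt ha,
      ← hν.two_mul_measure_sub_one (ha0 i) (ha0 j)]
    simp only [hcentred]
    rw [map_measureReal_apply_of_aemeasurable hY (measurableSet_lt measurable_const (by fun_prop))]
    rfl
  · have hsub := hν.map_sub_prod
    have : IsProbabilityMeasure ((ν.prod ν).map fun p => p.1 - p.2) :=
      Measure.isProbabilityMeasure_map (by fun_prop)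
    rw [kendall, ← ha i j, ← norm_mul_norm_eq_sqrt ha,
      ← hsub.two_mul_measure_sub_one (ha0 i) (ha0 j)]
    set f : EuclideanSpace ℝ (Fin N) → ℝ × ℝ := fun y => (m i + ⟪a i, y⟫, m j + ⟪a j, y⟫)
    have hf : Measurable f := by fun_prop
    have hlaw : P.map (fun ω => (X i ω, X j ω)) = ν.map f := by
      rw [AEMeasurable.map_map_of_aemeasurable hf.aemeasurable hY]
      congr 1
      ext ω <;> simp [f, hXY]
    rw [hlaw, Measure.map_prod_map _ _ hf hf, map_measureReal_apply (by fun_prop)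
      (measurableSet_lt measurable_const (by fun_prop)), map_measureReal_apply (by fun_prop)
      (measurableSet_lt measurable_const (by fun_prop))]
    congr 3
    ext p
    simp [f, inner_sub_right]

/-- The standardization `x ↦ Λ^{-1/2} (x - m)`, with values in Euclidean space, where the linear
isometries act. -/
noncomputable def whiten (Λ : Matrix (Fin N) (Fin N) ℝ) (m x : Fin N → ℝ) :
    EuclideanSpace ℝ (Fin N) :=
  WithLp.toLp 2 ((CFC.sqrt Λ)⁻¹.mulVec (x - m))

lemma measurable_whiten (m : Fin N → ℝ) : Measurable (whiten Λ m) := by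
  unfold whiten
  fun_prop

lemma transpose_sqrt (Λ : Matrix (Fin N) (Fin N) ℝ) : (CFC.sqrt Λ).transpose = CFC.sqrt Λ := by
  have h : star (CFC.sqrt Λ) = CFC.sqrt Λ := (CFC.sqrt_nonneg Λ).isSelfAdjoint
  rwa [Matrix.star_eq_conjTranspose, Matrix.conjTranspose_eq_transpose_of_trivial] at h

lemma sqrt_mul_sqrt (hΛ : Λ.PosDef) : CFC.sqrt Λ * CFC.sqrt Λ = Λ :=
  CFC.sqrt_mul_sqrt_self Λ hΛ.posSemidef.nonneg

lemma isUnit_det_sqrt (hΛ : Λ.PosDef) : IsUnit (CFC.sqrt Λ).det := by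
  have h := hΛ.det_pos
  rw [← sqrt_mul_sqrt hΛ, Matrix.det_mul] at h
  exact (left_ne_zero_of_mul h.ne').isUnit

/-- If the standardized vector is spherical, the rows of `Λ^{1/2}` are the vectors `a i` of a
spherical representation. -/
lemma hasSphericalRepresentation_of_whiten (hΛ : Λ.PosDef) (m : Fin N → ℝ)
    (hX : AEMeasurable (fun ω i => X i ω) P)
    (h : IsSpherical ((P.map fun ω i => X i ω).map (whiten Λ m))) :
    HasSphericalRepresentation Λ P X := by
  refine ⟨m, fun i => WithLp.toLp 2 (CFC.sqrt Λ i), fun ω => whiten Λ m fun i => X i ω,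
    fun i j => ?_, (measurable_whiten m).comp_aemeasurable hX, ?_, fun i ω => ?_⟩
  · have h1 := congrFun (congrFun (sqrt_mul_sqrt hΛ) j) i
    have h2 : ∀ k l, CFC.sqrt Λ k l = CFC.sqrt Λ l k := fun k l =>
      congrFun (congrFun (transpose_sqrt Λ) l) k
    have h3 : Λ i j = Λ j i := by simpa using (hΛ.isHermitian.apply i j).symm
    rw [h3, ← h1, Matrix.mul_apply]
    simp only [PiLp.inner_apply, RCLike.inner_apply, RCLike.conj_to_real]
    exact Finset.sum_congr rfl fun k _ => by rw [h2 i k]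
  · rwa [AEMeasurable.map_map_of_aemeasurable (measurable_whiten m).aemeasurable hX] at h
  · have h1 : (CFC.sqrt Λ).mulVec ((CFC.sqrt Λ)⁻¹.mulVec ((fun i => X i ω) - m)) =
        (fun i => X i ω) - m := by
      rw [Matrix.mulVec_mulVec, Matrix.mul_nonsing_inv _ (isUnit_det_sqrt hΛ), Matrix.one_mulVec]
    have h2 := congrFun h1 i
    simp only [Matrix.mulVec, dotProduct, Pi.sub_apply] at h2
    simp only [whiten, PiLp.inner_apply, RCLike.inner_apply, RCLike.conj_to_real, Matrix.mulVec,
      dotProduct, Pi.sub_apply]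
    rw [Finset.sum_congr rfl fun k _ => mul_comm _ _, h2]
    ring

end SphericalRepresentation

section Elliptical

lemma map_withDensity_comp {α β : Type*} [MeasurableSpace α] [MeasurableSpace β] {μ : Measure α}
    {f : α → β} (hf : Measurable f) {k : β → ENNReal} (hk : Measurable k) :
    (μ.withDensity (k ∘ f)).map f = (μ.map f).withDensity k := by
  ext s hs
  rw [Measure.map_apply hf hs, withDensity_apply _ (hf hs), withDensity_apply _ hs,
    setLIntegral_map hs hk hf]
  rfl

variable {N : ℕ} {Λ : Matrix (Fin N) (Fin N) ℝ}

/-- `whiten` maps the Lebesgue measure to a Haar measure; the determinant is immaterial here. -/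
lemma isAddHaarMeasure_map_whiten (hΛ : Λ.PosDef) (m : Fin N → ℝ) :
    ((volume : Measure (Fin N → ℝ)).map (whiten Λ m)).IsAddHaarMeasure := by
  have hu := isUnit_det_sqrt hΛ
  let L : (Fin N → ℝ) ≃L[ℝ] EuclideanSpace ℝ (Fin N) :=
    ((Matrix.toLin'OfInv (Matrix.mul_nonsing_inv _ hu) (Matrix.nonsing_inv_mul _ hu)).trans
      (WithLp.linearEquiv 2 ℝ (Fin N → ℝ)).symm).toContinuousLinearEquiv
  have hw : whiten Λ m = L ∘ fun x => x - m := by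
    ext x i
    simp [L, whiten, Matrix.mulVec_sub]
  rw [hw, ← Measure.map_map L.continuous.measurable (by fun_prop),
    (measurePreserving_sub_right volume m).map_eq]
  exact L.isAddHaarMeasure_map volume

lemma map_isometry_of_isAddHaarMeasure {E : Type*} [NormedAddCommGroup E] [InnerProductSpace ℝ E]
    [FiniteDimensional ℝ E] [MeasurableSpace E] [BorelSpace E] (μ : Measure E) [μ.IsAddHaarMeasure]
    (R : E ≃ₗᵢ[ℝ] E) : μ.map R = μ := by
  rw [Measure.isAddLeftInvariant_eq_smul μ volume, Measure.map_smul, R.measurePreserving.map_eq]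

lemma isSpherical_withDensity {E : Type*} [NormedAddCommGroup E] [InnerProductSpace ℝ E]
    [FiniteDimensional ℝ E] [MeasurableSpace E] [BorelSpace E] (μ : Measure E) [μ.IsAddHaarMeasure]
    {k : E → ENNReal} (hk : Measurable k) (hR : ∀ (R : E ≃ₗᵢ[ℝ] E) y, k (R y) = k y) :
    IsSpherical (μ.withDensity k) where
  map_eq R := by
    have h : k ∘ R = k := funext (hR R)
    conv_lhs => rw [← h]
    rw [map_withDensity_comp R.continuous.measurable hk, map_isometry_of_isAddHaarMeasure]
  hyperplane_null v hv c := by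
    refine withDensity_absolutelyContinuous μ k ?_
    have hvv : ⟪v, v⟫ ≠ 0 := by simpa using hv
    by_cases hc : ∃ y₀, ⟪v, y₀⟫ = c
    · obtain ⟨y₀, hy₀⟩ := hc
      have hset : {y | ⟪v, y⟫ = c} = (fun y => y + -y₀) ⁻¹'
          (LinearMap.ker (innerₛₗ ℝ v) : Set E) := by
        ext y
        simp [inner_add_right, add_neg_eq_zero, hy₀]
      rw [hset, measure_preimage_add_right]
      refine Measure.addHaar_submodule μ _ fun htop => hvv ?_
      have : v ∈ LinearMap.ker (innerₛₗ ℝ v) := by rw [htop]; trivial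
      simpa using this
    · have : {y | ⟪v, y⟫ = c} = ∅ := Set.eq_empty_of_forall_notMem fun y hy => hc ⟨y, hy⟩
      rw [this, measure_empty]

lemma quadraticForm_inv_eq_norm_whiten_sq (hΛ : Λ.PosDef) (m x : Fin N → ℝ) :
    (x - m) ⬝ᵥ (Λ⁻¹.mulVec (x - m)) = ‖whiten Λ m x‖ ^ 2 := by
  have hinv : Λ⁻¹ = (CFC.sqrt Λ)⁻¹ * (CFC.sqrt Λ)⁻¹ := by
    rw [← Matrix.mul_inv_rev, sqrt_mul_sqrt hΛ]
  have hsymm : ((CFC.sqrt Λ)⁻¹).transpose = (CFC.sqrt Λ)⁻¹ := by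
    rw [Matrix.transpose_nonsing_inv, transpose_sqrt]
  rw [hinv, ← Matrix.mulVec_mulVec, Matrix.dotProduct_mulVec, ← Matrix.mulVec_transpose, hsymm,
    EuclideanSpace.real_norm_sq_eq]
  simp [whiten, dotProduct, pow_two]

lemma IsElliptical.hasSphericalRepresentation {Ω : Type*} [MeasurableSpace Ω] {P : Measure Ω}
    {X : Fin N → Ω → ℝ} (hΛ : Λ.PosDef) (hX : IsElliptical Λ P X) :
    HasSphericalRepresentation Λ P X := by
  obtain ⟨m, g, hg, -, -, hlaw⟩ := hX
  refine hasSphericalRepresentation_of_whiten hΛ m hlaw.aemeasurable ?_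
  have := isAddHaarMeasure_map_whiten hΛ m
  set k : EuclideanSpace ℝ (Fin N) → ENNReal := fun y =>
    ENNReal.ofReal (Λ.det ^ (-(1 / 2) : ℝ) * g (‖y‖ ^ 2)) with hk
  have hkm : Measurable k := by fun_prop
  have hdens : (fun x => ENNReal.ofReal (ellipticalDensity Λ m g x)) = k ∘ whiten Λ m := by
    ext x
    simp only [ellipticalDensity, quadraticForm_inv_eq_norm_whiten_sq hΛ, hk, Function.comp]
  rw [hlaw.map_eq, hdens, map_withDensity_comp (measurable_whiten m) hkm]
  exact isSpherical_withDensity _ hkm fun R y => by simp only [hk, R.norm_map]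

end Elliptical

section Gaussian

lemma isSpherical_stdGaussian {E : Type*} [NormedAddCommGroup E] [InnerProductSpace ℝ E]
    [FiniteDimensional ℝ E] [MeasurableSpace E] [BorelSpace E] : IsSpherical (stdGaussian E) where
  map_eq R := stdGaussian_map R
  hyperplane_null v hv c := by
    have h := IsGaussian.map_eq_gaussianReal (μ := stdGaussian E) (innerSL ℝ v)
    rw [variance_dual_stdGaussian, innerSL_apply_norm] at h
    have hna := nullSingletonClass_gaussianReal (μ := (stdGaussian E)[innerSL ℝ v])
      (v := (‖v‖ ^ 2).toNNReal) (by simpa using hv)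
    have h0 : (stdGaussian E).map (innerSL ℝ v) {c} = 0 := by rw [h]; exact measure_singleton c
    rwa [Measure.map_apply (by fun_prop) (measurableSet_singleton c)] at h0

variable {N : ℕ} {Λ : Matrix (Fin N) (Fin N) ℝ}

lemma hasSphericalRepresentation_multivariateGaussian (hΛ : Λ.PosDef)
    (m : EuclideanSpace ℝ (Fin N)) :
    HasSphericalRepresentation Λ (multivariateGaussian m Λ) coord := by
  have hmeas : Measurable fun (z : EuclideanSpace ℝ (Fin N)) (i : Fin N) => coord i z := by
    unfold coord
    fun_prop
  refine hasSphericalRepresentation_of_whiten hΛ (fun i => m i) hmeas.aemeasurable ?_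
  convert isSpherical_stdGaussian (E := EuclideanSpace ℝ (Fin N))
  rw [Measure.map_map (measurable_whiten _) hmeas, multivariateGaussian,
    Measure.map_map ((measurable_whiten _).comp hmeas) (by fun_prop)]
  convert Measure.map_id
  ext z i
  have h : (fun i => coord i (m + Matrix.toEuclideanCLM (𝕜 := ℝ) (CFC.sqrt Λ) z)) - (fun i => m i) =
      (CFC.sqrt Λ).mulVec (WithLp.ofLp z) := by
    ext j
    simp [coord, Matrix.ofLp_toEuclideanCLM]
  simp only [Function.comp, whiten, h, Matrix.mulVec_mulVec,
    Matrix.nonsing_inv_mul _ (isUnit_det_sqrt hΛ), Matrix.one_mulVec, id]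

lemma memLp_coord_multivariateGaussian (m : EuclideanSpace ℝ (Fin N)) (i : Fin N) :
    MemLp (coord i) 2 (multivariateGaussian m Λ) :=
  (EuclideanSpace.proj (𝕜 := ℝ) i).comp_memLp'
    (IsGaussian.memLp_two_id (μ := multivariateGaussian m Λ))

end Gaussian

/-! ### The networks -/

section Correlation

variable {N : ℕ} {Λ : Matrix (Fin N) (Fin N) ℝ}

/-- The correlation coefficients of a positive definite matrix lie in `[-1, 1]`: they are those of
a Gram matrix. -/
lemma div_sqrt_mem_Icc (hΛ : Λ.PosDef) (i j : Fin N) :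
    Λ i j / Real.sqrt (Λ i i * Λ j j) ∈ Set.Icc (-1 : ℝ) 1 := by
  obtain ⟨-, a, -, ha, -⟩ := hasSphericalRepresentation_multivariateGaussian hΛ 0
  rw [← ha i j, ← norm_mul_norm_eq_sqrt ha]
  exact abs_le.1 (abs_real_inner_div_norm_mul_norm_le_one (a i) (a j))

lemma maxSpanningTrees_arcsin (hΛ : Λ.PosDef) :
    maxSpanningTrees (Matrix.of fun i j =>
        2 / Real.pi * Real.arcsin (Λ i j / Real.sqrt (Λ i i * Λ j j))) =
      maxSpanningTrees (Matrix.of fun i j => Λ i j / Real.sqrt (Λ i i * Λ j j)) := by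
  refine maxSpanningTrees_eq_of_le_iff fun i j k l => ?_
  simp only [Matrix.of_apply]
  rw [mul_le_mul_iff_right₀ (div_pos two_pos Real.pi_pos),
    Real.strictMonoOn_arcsin.le_iff_le (div_sqrt_mem_Icc hΛ i j) (div_sqrt_mem_Icc hΛ k l)]

/-- The maximum spanning trees of the three networks of random variables with a spherical
representation are those of the matrix of correlation coefficients of `Λ`. -/
lemma HasSphericalRepresentation.trueMST_eq {Ω : Type*} [MeasurableSpace Ω] {P : Measure Ω}
    [IsProbabilityMeasure P] {X : Fin N → Ω → ℝ} (hX : HasSphericalRepresentation Λ P X)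
    (hΛ : Λ.PosDef) (hcov : ∀ i, MemLp (X i) 2 P) :
    trueMST pearson P X =
        maxSpanningTrees (Matrix.of fun i j => Λ i j / Real.sqrt (Λ i i * Λ j j)) ∧
      trueMST fechner P X =
        maxSpanningTrees (Matrix.of fun i j => Λ i j / Real.sqrt (Λ i i * Λ j j)) ∧
      trueMST kendall P X =
        maxSpanningTrees (Matrix.of fun i j => Λ i j / Real.sqrt (Λ i i * Λ j j)) := by
  have h := hX.correlations hΛ hcov
  refine ⟨?_, ?_, ?_⟩
  · simp only [trueMST, networkWeights, (h _ _).1]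
  · simp only [trueMST, networkWeights, (h _ _).2.1, maxSpanningTrees_arcsin hΛ]
  · simp only [trueMST, networkWeights, (h _ _).2.2, maxSpanningTrees_arcsin hΛ]

end Correlation

theorem theorem1 {N : ℕ} (Λ : Matrix (Fin N) (Fin N) ℝ) (hΛ : Λ.PosDef)
    {Ω : Type*} [MeasurableSpace Ω] (P : Measure Ω) [IsProbabilityMeasure P]
    (X : Fin N → Ω → ℝ) (hX : IsElliptical Λ P X) (hcov : ∀ i, MemLp (X i) 2 P) :
    -- the three correlations
    (∀ i j,
      pearson P (X i) (X j) = Λ i j / Real.sqrt (Λ i i * Λ j j) ∧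
      fechner P (X i) (X j) =
        2 / Real.pi * Real.arcsin (Λ i j / Real.sqrt (Λ i i * Λ j j)) ∧
      kendall P (X i) (X j) =
        2 / Real.pi * Real.arcsin (Λ i j / Real.sqrt (Λ i i * Λ j j))) ∧
    -- the true maximum spanning trees are the same in the three networks
    trueMST fechner P X = trueMST pearson P X ∧
    trueMST kendall P X = trueMST pearson P X ∧
    -- and they are those of each of the three networks of a Gaussian vector with covariance `Λ`
    (∀ m : EuclideanSpace ℝ (Fin N),
      trueMST pearson P X = trueMST pearson (multivariateGaussian m Λ) coord ∧
      trueMST pearson P X = trueMST fechner (multivariateGaussian m Λ) coord ∧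
      trueMST pearson P X = trueMST kendall (multivariateGaussian m Λ) coord) := by
  have hrep := hX.hasSphericalRepresentation hΛ
  obtain ⟨hp, hf, hk⟩ := hrep.trueMST_eq hΛ hcov
  refine ⟨hrep.correlations hΛ hcov, hf.trans hp.symm, hk.trans hp.symm, fun m => ?_⟩
  obtain ⟨hp', hf', hk'⟩ := (hasSphericalRepresentation_multivariateGaussian hΛ m).trueMST_eq hΛ
    (memLp_coord_multivariateGaussian m)
  exact ⟨hp.trans hp'.symm, hp.trans hf'.symm, hp.trans hk'.symm⟩
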